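/- **Theorem.** For every integer $n \ge 0$, the braid group on $n$ strings $$B_n=\bigl\langle \sigma_1,\dots,\sigma_{n-1}\ \big|\ \sigma_i\sigma_j=\sigma_j\sigma_i\ (|i-j|>1),\quad \sigma_i\sigma_j\sigma_i=\sigma_j\sigma_i\sigma_j\ (|i-j|=1)\bigr\rangle$$ (the trivial group for $n\le 1$) is residually finite: for every $g\in B_n$ with $g\neq 1$ there is a homomorphism $h$ from $B_n$ onto a finite group such that $h(g)\neq 1$. -/

import Mathlib

/-- The relators of Artin's presentation, on free generators `σ 0, …, σ (n - 2)`
(the generator usually written `σ_k` is the one of index `k - 1`):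
`σ_i σ_j (σ_j σ_i)⁻¹` for `|i - j| > 1`, and
`σ_i σ_j σ_i (σ_j σ_i σ_j)⁻¹` for `|i - j| = 1`. -/
def braidRels (n : ℕ) : Set (FreeGroup (Fin (n - 1))) :=
  {r | ∃ i j : Fin (n - 1), 1 < |(i : ℤ) - (j : ℤ)| ∧
      r = FreeGroup.of i * FreeGroup.of j * (FreeGroup.of j * FreeGroup.of i)⁻¹} ∪
  {r | ∃ i j : Fin (n - 1), |(i : ℤ) - (j : ℤ)| = 1 ∧
      r = FreeGroup.of i * FreeGroup.of j * FreeGroup.of i *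
        (FreeGroup.of j * FreeGroup.of i * FreeGroup.of j)⁻¹}

/-- The braid group `B_n` on `n` strings, by Artin's presentation with `n - 1` generators.
For `n = 0` and `n = 1` there are no generators and the group is trivial. -/
abbrev BraidGroup (n : ℕ) : Type :=
  PresentedGroup (braidRels n)

/-!
The proof is by induction on the number of strings, through the coset action of the braid group on
the subgroup of braids that fix the position of the last string. Write `B_m` for the braid group on
`m` strings.

Let `G = F ⋊ B_{n+1}` be the semidirect product, for Artin's representation, of the free group `F` of
rank `n + 1`, with generators `x_0, …, x_n`, by `B_{n+1}`, with generators `s_0, …, s_{n-1}`. Sending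
`s_i` to `σ_i` and `x_k` to the pure braid in which the last string winds around string `k` gives a
homomorphism `ψ : G → B_{n+2}` (`IsBraidFamily.isCombedFamily`, `IsCombedFamily.lift`). With
`t_k = σ_k ⋯ σ_n` for `0 ≤ k ≤ n + 1`, the generators satisfy `σ_i t_k = t_{k'} ψ(c_{i,k})`, where
`k'` is the image of `k` under the transposition of `i` and `i + 1`, and `c_{i,k}` is one of
`s_{i-1}`, `x_i`, `1`, `s_i` (`IsBraidFamily.mul_tailProd`). The point is that the formula
`σ_i (k, g) = (k', c_{i,k} g)` respects the braid relations in `G` itself, not only after `ψ`, so that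
`B_{n+2}` acts on `{0, …, n + 1} × G` (`IsCombedFamily.isBraidFamily_combPerm`). As
`(k, g) ↦ t_k ψ(g)` is equivariant and sends `(n + 1, 1)` to `1`, a braid that fixes the point
`(n + 1, 1)` is trivial. Faithfulness of Artin's representation is not needed.

The same formula defines an action on the finite set `{0, …, n + 1} × Q` for every finite quotient
`Q` of `G`, and a suitable `Q` exists because `G` is residually finite. Indeed free groups are
(`FreeGroup.residuallyFinite`), `B_{n+1}` is by induction, and residual finiteness passes to
semidirect products with finitely generated kernel (`SemidirectProduct.residuallyFinite`).
-/

/-! ### Residual finiteness of free groups and of semidirect products -/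

/-- For a word `w ≠ 1`, let `S` be the finite set of its suffixes, as elements of the free group. Left
multiplication by a generator is a partial bijection of `S`; extending it to a permutation gives an
action on `S` in which `w` sends `1` to `w`. -/
theorem FreeGroup.residuallyFinite (α : Type*) : Group.ResiduallyFinite (FreeGroup α) := by
  classical
  apply Group.residuallyFinite_of_forall_exists_finite_monoidHom
  intro w hw
  let S : Set (FreeGroup α) := {v | ∃ L : List (α × Bool), L <:+ w.toWord ∧ v = FreeGroup.mk L}
  have hS : S.Finite := by
    have : S ⊆ (w.toWord.tails.map FreeGroup.mk).toFinset := by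
      rintro v ⟨L, hL, rfl⟩
      simp only [List.coe_toFinset, Set.mem_ofPred_eq, List.mem_map, List.mem_tails]
      exact ⟨L, hL, rfl⟩
    exact (Finset.finite_toSet _).subset this
  have : Finite S := hS
  -- Left multiplication by a generator, as a bijection between two subsets of `S`.
  let e (a : α) : {v : S // FreeGroup.of a * v.1 ∈ S} ≃ {v : S // (FreeGroup.of a)⁻¹ * v.1 ∈ S} :=
    { toFun := fun v => ⟨⟨FreeGroup.of a * v.1.1, v.2⟩, by simp⟩
      invFun := fun v => ⟨⟨(FreeGroup.of a)⁻¹ * v.1.1, v.2⟩, by simp⟩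
      left_inv := fun v => by simp
      right_inv := fun v => by simp }
  let p : FreeGroup α →* Equiv.Perm S := FreeGroup.lift fun a => (e a).extendSubtype
  -- Reading `w` letter by letter from the right never leaves `S`, so that the choice of the
  -- extensions does not matter.
  have hone : (1 : FreeGroup α) ∈ S := ⟨[], List.nil_suffix, rfl⟩
  have key : ∀ L : List (α × Bool), L <:+ w.toWord →
      (p (FreeGroup.mk L) ⟨1, hone⟩ : FreeGroup α) = FreeGroup.mk L := by
    intro L
    induction L with
    | nil => intro _; rw [← FreeGroup.one_eq_mk]; simp
    | cons y L ih =>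
      intro hL
      have hL' : L <:+ w.toWord := (List.suffix_cons y L).trans hL
      have hmem : FreeGroup.mk L ∈ S := ⟨L, hL', rfl⟩
      have hval : p (FreeGroup.mk L) ⟨1, hone⟩ = ⟨FreeGroup.mk L, hmem⟩ := Subtype.ext (ih hL')
      have hsplit : FreeGroup.mk (y :: L) = FreeGroup.mk [y] * FreeGroup.mk L := by
        simp [FreeGroup.mul_mk]
      have hmem' : FreeGroup.mk [y] * FreeGroup.mk L ∈ S := ⟨y :: L, hL, hsplit.symm⟩
      rw [hsplit, _root_.map_mul, Equiv.Perm.mul_apply, hval]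
      obtain ⟨a, b⟩ := y
      cases b
      · have hinv : FreeGroup.mk [(a, false)] = (FreeGroup.of a)⁻¹ := by
          simp [FreeGroup.of, FreeGroup.invRev]
        rw [hinv] at hmem' ⊢
        have h : (e a).extendSubtype ⟨_, hmem'⟩ = ⟨FreeGroup.mk L, hmem⟩ := by
          rw [Equiv.extendSubtype_apply_of_mem _ _ (by simpa using hmem)]
          apply Subtype.ext
          simp [e]
        have h' : p (FreeGroup.of a)⁻¹ ⟨FreeGroup.mk L, hmem⟩ = ⟨_, hmem'⟩ := by
          rw [_root_.map_inv, Equiv.Perm.inv_eq_iff_eq]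
          simp only [p, FreeGroup.lift_apply_of]
          exact h.symm
        rw [h']
      · change (p (FreeGroup.of a) _ : FreeGroup α) = FreeGroup.of a * _
        simp only [p, FreeGroup.lift_apply_of]
        rw [Equiv.extendSubtype_apply_of_mem (e a) _ hmem']
        rfl
  have hfin : Finite (Equiv.Perm S) := inferInstance
  refine ⟨Equiv.Perm S, inferInstance, hfin, p, fun h => hw ?_⟩
  have := key w.toWord List.suffix_rfl
  rw [FreeGroup.mk_toWord, h] at this
  exact this.symm

theorem Group.ResiduallyFinite.exists_finite_quotient {G : Type*} [Group G]
    (hG : Group.ResiduallyFinite G) {g : G} (hg : g ≠ 1) :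
    ∃ N : Subgroup G, ∃ _ : N.Normal, Finite (G ⧸ N) ∧ QuotientGroup.mk' N g ≠ 1 := by
  obtain ⟨N, hN⟩ := Group.exists_finiteIndexNormalSubgroup_notMem g hg
  exact ⟨N.toSubgroup, inferInstance, inferInstance,
    fun h => hN ((QuotientGroup.eq_one_iff g).1 h)⟩

theorem Group.FG.finite_monoidHom (N Q : Type*) [Group N] [Group.FG N] [Group Q] [Finite Q] :
    Finite (N →* Q) := by
  obtain ⟨S, hS⟩ := Group.FG.out (G := N)
  refine Finite.of_injective (fun (f : N →* Q) (x : S) => f x) fun f g h => ?_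
  exact MonoidHom.eq_of_eqOn_dense hS fun x hx => congrFun h ⟨x, hx⟩

/-- The action of `N ⋊[φ] H` on `(N →* Q) × Q`: `H` acts by precomposition on the first factor, and
`a : N` sends `(f, q)` to `(f, f a * q)`. -/
def SemidirectProduct.homPerm {N H : Type*} [Group N] [Group H] (φ : H →* MulAut N)
    (Q : Type*) [Group Q] : N ⋊[φ] H →* Equiv.Perm ((N →* Q) × Q) :=
  letI act : MulAction (N ⋊[φ] H) ((N →* Q) × Q) :=
    { smul := fun a y =>
        (y.1.comp (φ a.right⁻¹).toMonoidHom, y.1 (φ a.right⁻¹ a.left) * y.2)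
      one_smul := fun y => by
        apply Prod.ext
        · ext x
          change y.1 (φ (1 : N ⋊[φ] H).right⁻¹ x) = y.1 x
          simp
        · change y.1 (φ (1 : N ⋊[φ] H).right⁻¹ (1 : N ⋊[φ] H).left) * y.2 = y.2
          simp
      mul_smul := fun a b y => by
        apply Prod.ext
        · ext x
          change y.1 (φ (a * b).right⁻¹ x) = y.1 (φ b.right⁻¹ (φ a.right⁻¹ x))
          simp [mul_inv_rev]
        · change y.1 (φ (a * b).right⁻¹ (a * b).left) * y.2 =
            y.1 (φ b.right⁻¹ (φ a.right⁻¹ a.left)) * (y.1 (φ b.right⁻¹ b.left) * y.2)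
          simp [mul_inv_rev, mul_assoc] }
  MulAction.toPermHom _ _

theorem SemidirectProduct.homPerm_inl {N H : Type*} [Group N] [Group H] (φ : H →* MulAut N)
    {Q : Type*} [Group Q] (a : N) (f : N →* Q) (q : Q) :
    homPerm φ Q (inl a) (f, q) = (f, f a * q) := by
  change (f.comp (φ (1 : H)⁻¹).toMonoidHom, f (φ (1 : H)⁻¹ a) * q) = _
  apply Prod.ext
  · ext x
    simp
  · simp

/-- An element outside `N` survives in a finite quotient of `H`. For an element of `N`, a finite
quotient `Q` of `N` separating it from `1` need not extend to the semidirect product, but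
`SemidirectProduct.homPerm` does, and it acts on a finite set because `N` is finitely generated. -/
theorem SemidirectProduct.residuallyFinite {N H : Type*} [Group N] [Group H] [Group.FG N]
    (hN : Group.ResiduallyFinite N) (hH : Group.ResiduallyFinite H) (φ : H →* MulAut N) :
    Group.ResiduallyFinite (N ⋊[φ] H) := by
  rw [Group.residuallyFinite_iff_exists_finiteIndex]
  intro g hg
  by_cases hr : g.right = 1
  · have hg' : g = inl g.left := by ext <;> simp [hr]
    have hl : g.left ≠ 1 := fun h => hg (by ext <;> simp [hr, h])
    obtain ⟨M, _, _, hM⟩ := hN.exists_finite_quotient hl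
    have := Group.FG.finite_monoidHom N (N ⧸ M)
    refine ⟨(homPerm φ (N ⧸ M)).ker, Subgroup.finiteIndex_ker _, fun h => hM ?_⟩
    rw [MonoidHom.mem_ker, hg'] at h
    have h' := Equiv.congr_fun h (QuotientGroup.mk' M, 1)
    rw [homPerm_inl] at h'
    simpa using congrArg Prod.snd h'
  · obtain ⟨M, _, _, hM⟩ := hH.exists_finite_quotient hr
    refine ⟨((QuotientGroup.mk' M).comp (rightHom (φ := φ))).ker, Subgroup.finiteIndex_ker _, ?_⟩
    simpa using hM

/-! ### Homomorphisms out of braid groups -/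

/-- The relations of Artin's presentation for the elements `s 0, …, s (n - 1)` of `G`; the further
values of `s` play no role. -/
structure IsBraidFamily {G : Type*} [Group G] (n : ℕ) (s : ℕ → G) : Prop where
  comm : ∀ i j, i + 1 < j → j < n → s i * s j = s j * s i
  braid : ∀ i, i + 1 < n → s i * s (i + 1) * s i = s (i + 1) * s i * s (i + 1)

/-- The homomorphism from the braid group on `n + 1` strings given by a family of `n` elements
satisfying the braid relations. -/
def IsBraidFamily.lift {G : Type*} [Group G] {n : ℕ} {s : ℕ → G} (hs : IsBraidFamily n s) :
    BraidGroup (n + 1) →* G :=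
  PresentedGroup.toGroup (f := fun i : Fin (n + 1 - 1) => s i) <| by
    rintro r (⟨i, j, hij, rfl⟩ | ⟨i, j, hij, rfl⟩)
    · have hi := i.2
      have hj := j.2
      simp only [map_mul, map_inv, FreeGroup.lift_apply_of, mul_inv_eq_one]
      rcases lt_abs.1 hij with h | h
      · exact (hs.comm j i (by omega) (by omega)).symm
      · exact hs.comm i j (by omega) (by omega)
    · have hi := i.2
      have hj := j.2
      simp only [map_mul, map_inv, FreeGroup.lift_apply_of, mul_inv_eq_one]
      rcases eq_or_eq_neg_of_abs_eq hij with h | h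
      · have h' : (i : ℕ) = j + 1 := by omega
        rw [h']
        exact (hs.braid j (by omega)).symm
      · have h' : (j : ℕ) = i + 1 := by omega
        rw [h']
        exact hs.braid i (by omega)

/-- A family of elements indexed by `Fin n`, extended by `1` to all natural numbers. -/
def extendByOne {G : Type*} [One G] {n : ℕ} (f : Fin n → G) (i : ℕ) : G :=
  if h : i < n then f ⟨i, h⟩ else 1

theorem extendByOne_of_lt {G : Type*} [One G] {n : ℕ} (f : Fin n → G) {i : ℕ} (h : i < n) :
    extendByOne f i = f ⟨i, h⟩ :=
  dif_pos h

/-- The standard generators `0, …, n - 1` of the braid group on `n + 1` strings, followed by `1`. -/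
def braidGen (n : ℕ) : ℕ → BraidGroup (n + 1) :=
  extendByOne fun i : Fin n => PresentedGroup.of (rels := braidRels (n + 1)) i

theorem isBraidFamily_braidGen (n : ℕ) : IsBraidFamily n (braidGen n) where
  comm i j hij hj := by
    rw [braidGen, extendByOne_of_lt _ hj, extendByOne_of_lt _ (by omega : i < n)]
    refine PresentedGroup.mk_eq_mk_of_mul_inv_mem (Or.inl ⟨⟨i, by omega⟩, ⟨j, hj⟩, ?_, rfl⟩)
    rw [lt_abs]
    right
    simp only
    omega
  braid i hi := by
    rw [braidGen, extendByOne_of_lt _ hi, extendByOne_of_lt _ (by omega : i < n)]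
    refine PresentedGroup.mk_eq_mk_of_mul_inv_mem (Or.inr ⟨⟨i, by omega⟩, ⟨i + 1, hi⟩, ?_, rfl⟩)
    simp

theorem IsBraidFamily.lift_braidGen {G : Type*} [Group G] {n : ℕ} {s : ℕ → G}
    (hs : IsBraidFamily n s) {i : ℕ} (hi : i < n) : hs.lift (braidGen n i) = s i := by
  rw [braidGen, extendByOne_of_lt _ hi]
  exact PresentedGroup.toGroup.of _

theorem mem_of_braidGen_mem {n : ℕ} (H : Subgroup (BraidGroup (n + 1)))
    (h : ∀ i < n, braidGen n i ∈ H) (b : BraidGroup (n + 1)) : b ∈ H := by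
  refine PresentedGroup.generated_by _ H (fun i => ?_) b
  have := h i i.2
  rwa [braidGen, extendByOne_of_lt _ i.2] at this

/-- A map between two sets with an action of the braid group is equivariant as soon as it commutes
with the generators. -/
theorem braidGroup_equivariant {n : ℕ} {X Y : Type*} (p : BraidGroup (n + 1) →* Equiv.Perm X)
    (q : BraidGroup (n + 1) →* Equiv.Perm Y) (f : X → Y)
    (h : ∀ i < n, ∀ x, f (p (braidGen n i) x) = q (braidGen n i) (f x))
    (b : BraidGroup (n + 1)) (x : X) : f (p b x) = q b (f x) := by
  let H : Subgroup (BraidGroup (n + 1)) :=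
    { carrier := {b | ∀ x, f (p b x) = q b (f x)}
      one_mem' := fun x => by simp
      mul_mem' := fun {a b} ha hb x => by
        rw [map_mul, map_mul, Equiv.Perm.mul_apply, Equiv.Perm.mul_apply, ha, hb]
      inv_mem' := fun {a} ha x => by
        rw [map_inv, map_inv, Equiv.Perm.eq_inv_iff_eq, ← ha, ← Equiv.Perm.mul_apply, mul_inv_cancel,
          Equiv.Perm.one_apply] }
  exact mem_of_braidGen_mem H h b x

/-! ### Combed families -/

/-- The relations satisfied, in the subgroup of braids on `n + 2` strings which fix the position of
the last string, by the standard generators `s 0, …, s (n - 1)` of the braid group on the other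
strings and the pure braids `x 0, …, x n` in which the last string winds once around another one.
The last two relations say that `s i` conjugates `x (i + 1)` to `x i` and fixes
`x (i + 1) * x i`. -/
structure IsCombedFamily {G : Type*} [Group G] (n : ℕ) (s x : ℕ → G) : Prop
    extends IsBraidFamily n s where
  comm_of_ne : ∀ i k, i < n → k ≤ n → k ≠ i → k ≠ i + 1 → s i * x k = x k * s i
  mul_succ : ∀ i, i < n → s i * x (i + 1) = x i * s i
  mul_pair : ∀ i, i < n → s i * (x (i + 1) * x i) = x (i + 1) * x i * s i

theorem IsCombedFamily.map {G G' : Type*} [Group G] [Group G'] {n : ℕ} {s x : ℕ → G}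
    (h : IsCombedFamily n s x) (f : G →* G') : IsCombedFamily n (f ∘ s) (f ∘ x) where
  comm i j hij hj := by simpa using congrArg f (h.comm i j hij hj)
  braid i hi := by simpa using congrArg f (h.braid i hi)
  comm_of_ne i k hi hk h1 h2 := by simpa using congrArg f (h.comm_of_ne i k hi hk h1 h2)
  mul_succ i hi := by simpa using congrArg f (h.mul_succ i hi)
  mul_pair i hi := by simpa using congrArg f (h.mul_pair i hi)

/-- The transposition of `i` and `i + 1`, on natural numbers. -/
def swapSucc (i k : ℕ) : ℕ := if k = i then i + 1 else if k = i + 1 then i else k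

/-- The factor picked up by the coset representative `t k = σ k * ⋯ * σ n` under the generator `i`:
`σ i * t k = t (swapSucc i k) * combFactor s x i k`, see `IsBraidFamily.mul_tailProd`. -/
def combFactor {G : Type*} [Group G] (s x : ℕ → G) (i k : ℕ) : G :=
  if k < i then s (i - 1) else if k = i then x i else if k = i + 1 then 1 else s i

section combFactor

variable {G : Type*} [Group G] (s x : ℕ → G) {i k : ℕ}

theorem swapSucc_self : swapSucc i i = i + 1 := by simp [swapSucc]

theorem swapSucc_succ : swapSucc i (i + 1) = i := by simp [swapSucc]

theorem swapSucc_of_ne (h : k ≠ i) (h' : k ≠ i + 1) : swapSucc i k = k := by simp [swapSucc, h, h']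

theorem combFactor_of_lt (h : k < i) : combFactor s x i k = s (i - 1) := by simp [combFactor, h]

theorem combFactor_self : combFactor s x i i = x i := by simp [combFactor]

theorem combFactor_succ : combFactor s x i (i + 1) = 1 := by simp [combFactor]

theorem combFactor_of_gt (h : i + 1 < k) : combFactor s x i k = s i := by
  rw [combFactor, if_neg (by omega), if_neg (by omega), if_neg (by omega)]

end combFactor

theorem swapSucc_comm {i j : ℕ} (hij : i + 1 < j) (k : ℕ) :
    swapSucc i (swapSucc j k) = swapSucc j (swapSucc i k) := by
  grind [swapSucc]

theorem swapSucc_braid (i k : ℕ) :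
    swapSucc i (swapSucc (i + 1) (swapSucc i k)) =
      swapSucc (i + 1) (swapSucc i (swapSucc (i + 1) k)) := by
  grind [swapSucc]

/-- The commutation relation for the action `(k, g) ↦ (swapSucc i k, combFactor s x i k * g)`. -/
theorem IsCombedFamily.combFactor_comm {G : Type*} [Group G] {n : ℕ} {s x : ℕ → G}
    (h : IsCombedFamily n s x) {i j k : ℕ} (hij : i + 1 < j) (hj : j < n + 1) (hk : k < n + 2) :
    combFactor s x i (swapSucc j k) * combFactor s x j k =
      combFactor s x j (swapSucc i k) * combFactor s x i k := by
  rcases lt_trichotomy k i with h1 | rfl | h1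
  · simp (disch := omega) only [swapSucc_of_ne, combFactor_of_lt]
    exact h.comm _ _ (by omega) (by omega)
  · simp (disch := omega) only [swapSucc_of_ne, swapSucc_self, combFactor_of_lt, combFactor_self]
    exact (h.comm_of_ne _ _ (by omega) (by omega) (by omega) (by omega)).symm
  obtain rfl | h1 := eq_or_lt_of_le (Nat.succ_le_of_lt h1)
  · simp (disch := omega) only [Nat.succ_eq_add_one, swapSucc_of_ne, swapSucc_succ,
      combFactor_of_lt, combFactor_succ, one_mul, mul_one]
  rcases lt_trichotomy k j with h2 | rfl | h2
  · simp (disch := omega) only [swapSucc_of_ne, combFactor_of_lt, combFactor_of_gt]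
    exact h.comm _ _ (by omega) (by omega)
  · simp (disch := omega) only [swapSucc_of_ne, swapSucc_self, combFactor_of_gt, combFactor_self]
    exact h.comm_of_ne _ _ (by omega) (by omega) (by omega) (by omega)
  obtain rfl | h2 := eq_or_lt_of_le (Nat.succ_le_of_lt h2)
  · simp (disch := omega) only [Nat.succ_eq_add_one, swapSucc_of_ne, swapSucc_succ,
      combFactor_of_gt, combFactor_succ, one_mul, mul_one]
  · simp (disch := omega) only [swapSucc_of_ne, combFactor_of_gt]
    exact h.comm _ _ (by omega) (by omega)

/-- The braid relation for the action `(k, g) ↦ (swapSucc i k, combFactor s x i k * g)`. Its cases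
`k = i` and `k = i + 1` are the relations `mul_pair` and `mul_succ` of a combed family. -/
theorem IsCombedFamily.combFactor_braid {G : Type*} [Group G] {n : ℕ} {s x : ℕ → G}
    (h : IsCombedFamily n s x) {i k : ℕ} (hi : i + 1 < n + 1) (hk : k < n + 2) :
    combFactor s x i (swapSucc (i + 1) (swapSucc i k)) *
        (combFactor s x (i + 1) (swapSucc i k) * combFactor s x i k) =
      combFactor s x (i + 1) (swapSucc i (swapSucc (i + 1) k)) *
        (combFactor s x i (swapSucc (i + 1) k) * combFactor s x (i + 1) k) := by
  rcases lt_trichotomy k i with h1 | rfl | h1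
  · simp (disch := omega) only [swapSucc_of_ne, combFactor_of_lt]
    obtain ⟨i, rfl⟩ : ∃ j, i = j + 1 := ⟨i - 1, by omega⟩
    simpa [mul_assoc] using h.braid i (by omega)
  · simp (disch := omega) only [swapSucc_of_ne, swapSucc_self, combFactor_of_lt, combFactor_of_gt,
      combFactor_self]
    simpa [mul_assoc] using h.mul_pair k (by omega)
  obtain rfl | h1 := eq_or_lt_of_le (Nat.succ_le_of_lt h1)
  · simp (disch := omega) only [Nat.succ_eq_add_one, swapSucc_of_ne, swapSucc_self, swapSucc_succ,
      combFactor_of_lt, combFactor_of_gt, combFactor_self, combFactor_succ]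
    simpa using (h.mul_succ i (by omega)).symm
  obtain rfl | h1 := eq_or_lt_of_le (Nat.succ_le_of_lt h1)
  · simp (disch := omega) only [Nat.succ_eq_add_one, swapSucc_of_ne, swapSucc_succ,
      combFactor_of_lt, combFactor_of_gt, combFactor_succ]
    simp
  · simp (disch := omega) only [swapSucc_of_ne, combFactor_of_gt]
    simpa [mul_assoc] using h.braid i (by omega)

/-- The permutation `(k, g) ↦ (swapSucc i k, combFactor s x i k * g)` of `Fin (n + 2) × G`, by which
the generator `i ≤ n` of the braid group on `n + 2` strings acts. -/
def combPerm {G : Type*} [Group G] (n : ℕ) (s x : ℕ → G) (i : ℕ) :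
    Equiv.Perm (Fin (n + 2) × G) :=
  Equiv.prodShear (Equiv.swap (Fin.ofNat (n + 2) i) (Fin.ofNat (n + 2) (i + 1)))
    fun k => Equiv.mulLeft (combFactor s x i k)

theorem combPerm_fst {G : Type*} [Group G] {n : ℕ} (s x : ℕ → G) {i : ℕ} (hi : i < n + 1)
    (y : Fin (n + 2) × G) : ((combPerm n s x i y).1 : ℕ) = swapSucc i y.1 := by
  have h0 : ((Fin.ofNat (n + 2) i : Fin (n + 2)) : ℕ) = i := Nat.mod_eq_of_lt (by omega)
  have h1 : ((Fin.ofNat (n + 2) (i + 1) : Fin (n + 2)) : ℕ) = i + 1 := Nat.mod_eq_of_lt (by omega)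
  change ((Equiv.swap (Fin.ofNat (n + 2) i) (Fin.ofNat (n + 2) (i + 1)) y.1 : Fin (n + 2)) : ℕ) = _
  rw [Equiv.swap_apply_def, swapSucc]
  simp only [Fin.ext_iff, h0, h1]
  split_ifs <;> simp_all

theorem combPerm_snd {G : Type*} [Group G] {n : ℕ} (s x : ℕ → G) {i : ℕ}
    (y : Fin (n + 2) × G) : (combPerm n s x i y).2 = combFactor s x i y.1 * y.2 :=
  rfl

theorem IsCombedFamily.isBraidFamily_combPerm {G : Type*} [Group G] {n : ℕ} {s x : ℕ → G}
    (h : IsCombedFamily n s x) : IsBraidFamily (n + 1) (combPerm n s x) where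
  comm i j hij hj := by
    have hi : i < n + 1 := by omega
    ext1 y
    simp only [Equiv.Perm.mul_apply]
    apply Prod.ext
    · simp only [Fin.ext_iff, combPerm_fst, hi, hj, swapSucc_comm hij]
    · simp only [combPerm_snd, combPerm_fst, hi, hj, ← mul_assoc,
        h.combFactor_comm hij hj y.1.2]
  braid i hi := by
    have hi' : i < n + 1 := by omega
    ext1 y
    simp only [Equiv.Perm.mul_apply]
    apply Prod.ext
    · simp only [Fin.ext_iff, combPerm_fst, hi, hi', swapSucc_braid]
    · have := h.combFactor_braid hi y.1.2
      simp only [combPerm_snd, combPerm_fst, hi, hi']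
      simp only [← mul_assoc] at this ⊢
      rw [this]

/-- A combed family in `G` makes the braid group on `n + 2` strings act on `Fin (n + 2) × G`. -/
def IsCombedFamily.action {G : Type*} [Group G] {n : ℕ} {s x : ℕ → G}
    (h : IsCombedFamily n s x) : BraidGroup (n + 2) →* Equiv.Perm (Fin (n + 2) × G) :=
  h.isBraidFamily_combPerm.lift

theorem IsCombedFamily.action_braidGen {G : Type*} [Group G] {n : ℕ} {s x : ℕ → G}
    (h : IsCombedFamily n s x) {i : ℕ} (hi : i < n + 1) :
    h.action (braidGen (n + 1) i) = combPerm n s x i :=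
  h.isBraidFamily_combPerm.lift_braidGen hi

/-! ### Combed families in braid groups -/

/-- The braid `σ k * σ (k + 1) * ⋯ * σ n`, which is `1` for `k = n + 1`. These represent the left
cosets, in the braid group on `n + 2` strings, of the subgroup fixing the position of the last
string. -/
def tailProd {G : Type*} [Group G] (n : ℕ) (σ : ℕ → G) (k : ℕ) : G :=
  ((List.range' k (n + 1 - k)).map σ).prod

section tailProd

variable {G : Type*} [Group G] {n : ℕ} {σ : ℕ → G}

theorem tailProd_last : tailProd n σ (n + 1) = 1 := by simp [tailProd]

theorem tailProd_of_le {k : ℕ} (hk : k ≤ n) : tailProd n σ k = σ k * tailProd n σ (k + 1) := by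
  have : n + 1 - k = (n + 1 - (k + 1)) + 1 := by omega
  rw [tailProd, tailProd, this, List.range'_succ]
  simp

theorem IsBraidFamily.mul_tailProd_of_succ_lt (h : IsBraidFamily (n + 1) σ) {i k : ℕ}
    (hik : i + 1 < k) (hk : k ≤ n + 1) : σ i * tailProd n σ k = tailProd n σ k * σ i := by
  induction hk using Nat.decreasingInduction with
  | self => simp [tailProd_last]
  | of_succ k hk ih =>
    rw [tailProd_of_le (by omega), ← mul_assoc, h.comm i k hik hk, mul_assoc, ih (by omega),
      mul_assoc]

theorem IsBraidFamily.succ_mul_tailProd_of_le (h : IsBraidFamily (n + 1) σ) {i k : ℕ}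
    (hki : k ≤ i) (hi : i < n) : σ (i + 1) * tailProd n σ k = tailProd n σ k * σ i := by
  induction hki using Nat.decreasingInduction with
  | self =>
    rw [tailProd_of_le (by omega), tailProd_of_le (by omega : i + 1 ≤ n), ← mul_assoc, ← mul_assoc,
      ← h.braid i (by omega), mul_assoc, mul_assoc, mul_assoc, mul_assoc,
      h.mul_tailProd_of_succ_lt (by omega) (by omega)]
  | of_succ k hk ih =>
    rw [tailProd_of_le (by omega), ← mul_assoc, ← h.comm k (i + 1) (by omega) (by omega), mul_assoc,
      ih, mul_assoc]

/-- The pure braid in which the last string winds once around string `k`. -/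
def windingBraid (n : ℕ) (σ : ℕ → G) (k : ℕ) : G :=
  (tailProd n σ (k + 1))⁻¹ * (σ k * σ k) * tailProd n σ (k + 1)

theorem IsBraidFamily.isCombedFamily (h : IsBraidFamily (n + 1) σ) :
    IsCombedFamily n σ (windingBraid n σ) where
  comm i j hij hj := h.comm i j hij (by omega)
  braid i hi := h.braid i (by omega)
  comm_of_ne i k hi hk h1 h2 := by
    change Commute (σ i) _
    rcases lt_or_gt_of_ne h1 with hlt | hgt
    · have hc : Commute (σ (i + 1)) (σ k) := (h.comm k (i + 1) (by omega) (by omega)).symm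
      have ht := h.succ_mul_tailProd_of_le (i := i) (k := k + 1) (by omega) hi
      have : σ i = (tailProd n σ (k + 1))⁻¹ * σ (i + 1) * tailProd n σ (k + 1) := by
        rw [mul_assoc, ht, inv_mul_cancel_left]
      rw [this, windingBraid]
      have hc2 := hc.mul_right hc
      simpa using (Commute.conj_iff (tailProd n σ (k + 1))⁻¹).2 hc2
    · have hc : Commute (σ i) (σ k) := h.comm i k (by omega) (by omega)
      have ht : Commute (σ i) (tailProd n σ (k + 1)) :=
        h.mul_tailProd_of_succ_lt (by omega) (by omega)
      exact (ht.inv_right.mul_right (hc.mul_right hc)).mul_right ht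
  mul_succ i hi := by
    have hb := h.braid i (by omega)
    have ht : Commute (σ i) (tailProd n σ (i + 2)) :=
      h.mul_tailProd_of_succ_lt (by omega) (by omega)
    rw [windingBraid, windingBraid, tailProd_of_le (by omega : i + 1 ≤ n)]
    have key : σ i * (σ (i + 1) * σ (i + 1)) = (σ (i + 1))⁻¹ * (σ i * σ i) * σ (i + 1) * σ i := by
      rw [mul_assoc, mul_assoc, eq_inv_mul_iff_mul_eq]
      calc σ (i + 1) * (σ i * (σ (i + 1) * σ (i + 1)))
          = σ (i + 1) * σ i * σ (i + 1) * σ (i + 1) := by simp only [mul_assoc]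
        _ = σ i * σ (i + 1) * σ i * σ (i + 1) := by rw [hb]
        _ = σ i * (σ (i + 1) * σ i * σ (i + 1)) := by simp only [mul_assoc]
        _ = _ := by rw [← hb]; simp only [mul_assoc]
    calc σ i * ((tailProd n σ (i + 2))⁻¹ * (σ (i + 1) * σ (i + 1)) * tailProd n σ (i + 2))
        = (tailProd n σ (i + 2))⁻¹ * (σ i * (σ (i + 1) * σ (i + 1))) * tailProd n σ (i + 2) := by
          rw [← mul_assoc, ← mul_assoc, ht.inv_right.eq]
          simp only [mul_assoc]
      _ = (tailProd n σ (i + 2))⁻¹ * ((σ (i + 1))⁻¹ * (σ i * σ i) * σ (i + 1)) *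
          (σ i * tailProd n σ (i + 2)) := by
          rw [key]
          simp only [mul_assoc]
      _ = _ := by
          rw [ht.eq, mul_inv_rev]
          simp only [mul_assoc]
  mul_pair i hi := by
    have hb := h.braid i (by omega)
    have ht : Commute (σ i) (tailProd n σ (i + 2)) :=
      h.mul_tailProd_of_succ_lt (by omega) (by omega)
    have hp : windingBraid n σ (i + 1) * windingBraid n σ i =
        (tailProd n σ (i + 2))⁻¹ * (σ (i + 1) * (σ i * σ i) * σ (i + 1)) * tailProd n σ (i + 2) := by
      rw [windingBraid, windingBraid, tailProd_of_le (by omega : i + 1 ≤ n)]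
      group
    have hc : Commute (σ i) (σ (i + 1) * (σ i * σ i) * σ (i + 1)) := by
      change _ = _
      calc σ i * (σ (i + 1) * (σ i * σ i) * σ (i + 1))
          = (σ i * σ (i + 1) * σ i) * (σ i * σ (i + 1)) := by simp only [mul_assoc]
        _ = σ (i + 1) * σ i * (σ (i + 1) * σ i * σ (i + 1)) := by rw [hb]; simp only [mul_assoc]
        _ = _ := by rw [← hb]; simp only [mul_assoc]
    rw [hp]
    exact (ht.inv_right.mul_right hc).mul_right ht

/-- The generators permute the left cosets represented by the elements `tailProd n σ k`, and
`combFactor` is the resulting cocycle. -/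
theorem IsBraidFamily.mul_tailProd (h : IsBraidFamily (n + 1) σ) {i k : ℕ} (hi : i < n + 1)
    (hk : k < n + 2) : σ i * tailProd n σ k =
      tailProd n σ (swapSucc i k) * combFactor σ (windingBraid n σ) i k := by
  rcases lt_trichotomy k i with h1 | rfl | h1
  · simp (disch := omega) only [swapSucc_of_ne, combFactor_of_lt]
    obtain ⟨i, rfl⟩ : ∃ j, i = j + 1 := ⟨i - 1, by omega⟩
    exact h.succ_mul_tailProd_of_le (by omega) (by omega)
  · rw [swapSucc_self, combFactor_self, windingBraid, tailProd_of_le (by omega : k ≤ n)]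
    simp only [mul_assoc, mul_inv_cancel_left]
  obtain rfl | h1 := eq_or_lt_of_le (Nat.succ_le_of_lt h1)
  · rw [Nat.succ_eq_add_one, swapSucc_succ, combFactor_succ, mul_one, tailProd_of_le (k := i)]
    omega
  · simp (disch := omega) only [swapSucc_of_ne, combFactor_of_gt]
    exact h.mul_tailProd_of_succ_lt (by omega) (by omega)

end tailProd

/-! ### Artin's action on the free group -/

/-- The generators `0, …, n` of the free group of rank `n + 1`, followed by `1`. -/
def freeGen (n : ℕ) : ℕ → FreeGroup (Fin (n + 1)) := extendByOne FreeGroup.of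

theorem freeGen_hom_ext {n : ℕ} {G : Type*} [Group G] {f g : FreeGroup (Fin (n + 1)) →* G}
    (h : ∀ k < n + 1, f (freeGen n k) = g (freeGen n k)) : f = g := by
  ext k
  have := h k k.2
  rwa [freeGen, extendByOne_of_lt _ k.2] at this

/-- The homomorphism from the free group of rank `n + 1` given by the images of its generators. -/
def freeLift {G : Type*} [Group G] (n : ℕ) (f : ℕ → G) : FreeGroup (Fin (n + 1)) →* G :=
  FreeGroup.lift fun k => f k

theorem freeLift_freeGen {G : Type*} [Group G] {n k : ℕ} (f : ℕ → G) (hk : k < n + 1) :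
    freeLift n f (freeGen n k) = f k := by
  rw [freeGen, extendByOne_of_lt _ hk, freeLift, FreeGroup.lift_apply_of]

/-- Artin's automorphism of the free group attached to the generator `i < n`, as an endomorphism: it
is conjugation by `s i` on the elements `x k` of a combed family. -/
def artinHom (n i : ℕ) : FreeGroup (Fin (n + 1)) →* FreeGroup (Fin (n + 1)) :=
  freeLift n fun k =>
    if k = i then (freeGen n i)⁻¹ * freeGen n (i + 1) * freeGen n i
    else if k = i + 1 then freeGen n i else freeGen n k

/-- The inverse of `artinHom n i` for `i < n`. -/
def artinHomInv (n i : ℕ) : FreeGroup (Fin (n + 1)) →* FreeGroup (Fin (n + 1)) :=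
  freeLift n fun k =>
    if k = i then freeGen n (i + 1)
    else if k = i + 1 then freeGen n (i + 1) * freeGen n i * (freeGen n (i + 1))⁻¹ else freeGen n k

section artin

variable {n i k : ℕ}

theorem artinHom_self (hi : i < n) : artinHom n i (freeGen n i) =
    (freeGen n i)⁻¹ * freeGen n (i + 1) * freeGen n i := by
  rw [artinHom, freeLift_freeGen _ (by omega)]
  simp

theorem artinHom_succ (hi : i < n) : artinHom n i (freeGen n (i + 1)) = freeGen n i := by
  rw [artinHom, freeLift_freeGen _ (by omega)]
  simp

theorem artinHom_of_ne (hk : k < n + 1) (h : k ≠ i) (h' : k ≠ i + 1) :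
    artinHom n i (freeGen n k) = freeGen n k := by
  rw [artinHom, freeLift_freeGen _ hk]
  simp [h, h']

theorem artinHomInv_self (hi : i < n) : artinHomInv n i (freeGen n i) = freeGen n (i + 1) := by
  rw [artinHomInv, freeLift_freeGen _ (by omega)]
  simp

theorem artinHomInv_succ (hi : i < n) : artinHomInv n i (freeGen n (i + 1)) =
    freeGen n (i + 1) * freeGen n i * (freeGen n (i + 1))⁻¹ := by
  rw [artinHomInv, freeLift_freeGen _ (by omega)]
  simp

theorem artinHomInv_of_ne (hk : k < n + 1) (h : k ≠ i) (h' : k ≠ i + 1) :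
    artinHomInv n i (freeGen n k) = freeGen n k := by
  rw [artinHomInv, freeLift_freeGen _ hk]
  simp [h, h']

theorem artinHomInv_comp_artinHom (hi : i < n) :
    (artinHomInv n i).comp (artinHom n i) = MonoidHom.id _ := by
  refine freeGen_hom_ext fun k hk => ?_
  by_cases h : k = i
  · subst h
    simp [artinHom_self, artinHomInv_self, artinHomInv_succ, hi, mul_assoc]
  by_cases h' : k = i + 1
  · subst h'
    simp [artinHom_succ, artinHomInv_self, hi]
  · simp [artinHom_of_ne, artinHomInv_of_ne, hk, h, h']

theorem artinHom_comp_artinHomInv (hi : i < n) :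
    (artinHom n i).comp (artinHomInv n i) = MonoidHom.id _ := by
  refine freeGen_hom_ext fun k hk => ?_
  by_cases h : k = i
  · subst h
    simp [artinHom_succ, artinHomInv_self, hi]
  by_cases h' : k = i + 1
  · subst h'
    simp [artinHom_self, artinHom_succ, artinHomInv_succ, hi, mul_assoc]
  · simp [artinHom_of_ne, artinHomInv_of_ne, hk, h, h']

end artin

/-- Artin's automorphisms `0, …, n - 1` of the free group of rank `n + 1`, followed by `1`. -/
def artinAut (n : ℕ) : ℕ → MulAut (FreeGroup (Fin (n + 1))) :=
  extendByOne fun i : Fin n => MonoidHom.toMulEquiv (artinHom n i) (artinHomInv n i)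
    (artinHomInv_comp_artinHom i.2) (artinHom_comp_artinHomInv i.2)

theorem artinAut_apply {n i : ℕ} (hi : i < n) (a : FreeGroup (Fin (n + 1))) :
    artinAut n i a = artinHom n i a := by
  rw [artinAut, extendByOne_of_lt _ hi]
  rfl

theorem isBraidFamily_artinAut (n : ℕ) : IsBraidFamily n (artinAut n) where
  comm i j hij hj := by
    have hi : i < n := by omega
    suffices H : (artinHom n i).comp (artinHom n j) = (artinHom n j).comp (artinHom n i) by
      ext1 a
      simpa only [MulAut.mul_apply, artinAut_apply hi, artinAut_apply hj, MonoidHom.comp_apply] using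
        DFunLike.congr_fun H a
    refine freeGen_hom_ext fun k hk => ?_
    simp only [MonoidHom.comp_apply]
    by_cases h1 : k = i
    · subst h1
      simp (disch := omega) only [artinHom_self, artinHom_of_ne, map_mul, map_inv]
    by_cases h2 : k = i + 1
    · subst h2
      simp (disch := omega) only [artinHom_succ, artinHom_of_ne]
    by_cases h3 : k = j
    · subst h3
      simp (disch := omega) only [artinHom_self, artinHom_of_ne, map_mul, map_inv]
    by_cases h4 : k = j + 1
    · subst h4
      simp (disch := omega) only [artinHom_succ, artinHom_of_ne]
    · simp (disch := omega) only [artinHom_of_ne]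
  braid i hi := by
    have hi' : i < n := by omega
    suffices H : (artinHom n i).comp ((artinHom n (i + 1)).comp (artinHom n i)) =
        (artinHom n (i + 1)).comp ((artinHom n i).comp (artinHom n (i + 1))) by
      ext1 a
      simpa only [MulAut.mul_apply, artinAut_apply hi, artinAut_apply hi',
        MonoidHom.comp_apply] using
        DFunLike.congr_fun H a
    refine freeGen_hom_ext fun k hk => ?_
    simp only [MonoidHom.comp_apply]
    by_cases h1 : k = i
    · subst h1
      simp (disch := omega) only [artinHom_self, artinHom_succ, artinHom_of_ne, map_mul, map_inv]
      group
    by_cases h2 : k = i + 1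
    · subst h2
      simp (disch := omega) only [artinHom_self, artinHom_succ, artinHom_of_ne, map_mul, map_inv]
    by_cases h3 : k = i + 1 + 1
    · subst h3
      simp (disch := omega) only [artinHom_succ, artinHom_of_ne]
    · simp (disch := omega) only [artinHom_of_ne]

/-- Artin's representation of the braid group on `n + 1` strings. -/
def artinRep (n : ℕ) : BraidGroup (n + 1) →* MulAut (FreeGroup (Fin (n + 1))) :=
  (isBraidFamily_artinAut n).lift

theorem artinRep_braidGen {n i : ℕ} (hi : i < n) (a : FreeGroup (Fin (n + 1))) :
    artinRep n (braidGen n i) a = artinHom n i a := by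
  rw [artinRep, (isBraidFamily_artinAut n).lift_braidGen hi, artinAut_apply hi]

/-- The semidirect product of the free group of rank `n + 1` by the braid group on `n + 1` strings,
for Artin's representation. It maps to the braid group on `n + 2` strings, onto the subgroup which
fixes the position of the last string. -/
abbrev CombedGroup (n : ℕ) : Type := FreeGroup (Fin (n + 1)) ⋊[artinRep n] BraidGroup (n + 1)

open SemidirectProduct in
theorem isCombedFamily_combedGroup (n : ℕ) :
    IsCombedFamily (G := CombedGroup n) n (inr ∘ braidGen n) (inl ∘ freeGen n) := by
  have key {i : ℕ} (hi : i < n) (a : FreeGroup (Fin (n + 1))) :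
      (inr (braidGen n i) * inl a : CombedGroup n) = inl (artinHom n i a) * inr (braidGen n i) := by
    rw [← artinRep_braidGen hi, inl_aut, map_inv, inv_mul_cancel_right]
  refine ⟨⟨?_, ?_⟩, ?_, ?_, ?_⟩
  · intro i j hij hj
    simp only [Function.comp_apply, ← map_mul, (isBraidFamily_braidGen n).comm i j hij hj]
  · intro i hi
    simp only [Function.comp_apply, ← map_mul, (isBraidFamily_braidGen n).braid i hi]
  · intro i k hi hk h1 h2
    rw [Function.comp_apply, Function.comp_apply, key hi, artinHom_of_ne (by omega) h1 h2]
  · intro i hi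
    simp only [Function.comp_apply]
    rw [key hi, artinHom_succ hi]
  · intro i hi
    simp only [Function.comp_apply]
    rw [← map_mul, key hi, map_mul, artinHom_succ hi, artinHom_self hi]
    simp [mul_assoc]

/-- The homomorphism from `CombedGroup n` given by a combed family: the relations of a combed family
are a presentation of the semidirect product. -/
def IsCombedFamily.lift {G : Type*} [Group G] {n : ℕ} {s x : ℕ → G} (h : IsCombedFamily n s x) :
    CombedGroup n →* G :=
  SemidirectProduct.lift (freeLift n x) h.toIsBraidFamily.lift <| by
    let H : Subgroup (BraidGroup (n + 1)) :=
      { carrier := {b | ∀ a, freeLift n x (artinRep n b a) =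
          h.toIsBraidFamily.lift b * freeLift n x a * (h.toIsBraidFamily.lift b)⁻¹}
        one_mem' := fun a => by simp
        mul_mem' := fun {b c} hb hc a => by
          rw [map_mul, MulAut.mul_apply, hb, hc, map_mul]
          group
        inv_mem' := fun {b} hb a => by
          have := hb (artinRep n b⁻¹ a)
          rw [← MulAut.mul_apply, ← map_mul, mul_inv_cancel, map_one, MulAut.one_apply] at this
          rw [this, map_inv h.toIsBraidFamily.lift, inv_inv]
          simp only [mul_assoc, inv_mul_cancel_left, inv_mul_cancel, mul_one] }
    intro b
    ext1 a
    suffices hb : b ∈ H by simpa using hb (FreeGroup.of a)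
    refine mem_of_braidGen_mem H (fun i hi a => ?_) b
    rw [artinRep_braidGen hi, h.toIsBraidFamily.lift_braidGen hi]
    suffices H : (freeLift n x).comp (artinHom n i) =
        (MulAut.conj (s i)).toMonoidHom.comp (freeLift n x) from DFunLike.congr_fun H a
    refine freeGen_hom_ext fun k hk => ?_
    simp only [MonoidHom.comp_apply, MulEquiv.coe_toMonoidHom, MulAut.conj_apply]
    rw [eq_mul_inv_iff_mul_eq]
    have h1 := h.mul_succ i hi
    by_cases hk1 : k = i
    · subst hk1
      simp (disch := omega) only [artinHom_self, map_mul, map_inv, freeLift_freeGen]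
      have h2 := h.mul_pair k hi
      rw [← mul_assoc, h1] at h2
      rw [mul_assoc, mul_assoc, inv_mul_eq_iff_eq_mul, ← mul_assoc, ← mul_assoc, ← h2]
    by_cases hk2 : k = i + 1
    · subst hk2
      simp (disch := omega) only [artinHom_succ, freeLift_freeGen]
      exact h1.symm
    · simp (disch := omega) only [artinHom_of_ne, freeLift_freeGen]
      exact (h.comm_of_ne i k hi (by omega) hk1 hk2).symm

theorem IsCombedFamily.lift_combFactor {G : Type*} [Group G] {n : ℕ} {s x : ℕ → G}
    (h : IsCombedFamily n s x) {i k : ℕ} (hi : i < n + 1) (hk : k < n + 2) :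
    h.lift (combFactor (SemidirectProduct.inr ∘ braidGen n) (SemidirectProduct.inl ∘ freeGen n)
      i k) = combFactor s x i k := by
  have hs {j : ℕ} (hj : j < n) : h.lift (SemidirectProduct.inr (braidGen n j)) = s j := by
    rw [IsCombedFamily.lift, SemidirectProduct.lift_inr, h.toIsBraidFamily.lift_braidGen hj]
  have hx {j : ℕ} (hj : j < n + 1) : h.lift (SemidirectProduct.inl (freeGen n j)) = x j := by
    rw [IsCombedFamily.lift, SemidirectProduct.lift_inl, freeLift_freeGen _ hj]
  unfold combFactor
  split_ifs
  · exact hs (by omega)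
  · exact hx hi
  · exact map_one _
  · exact hs (by omega)

/-! ### Residual finiteness of braid groups -/

/-- If `b ≠ 1`, then `b` moves the base point `(n + 1, 1)` of `Fin (n + 2) × CombedGroup n`, because
the image of that point under the coset decomposition is `1` and is sent to `b`. The action and this
fact pass to `Fin (n + 2) × Q` for a suitable finite quotient `Q` of `CombedGroup n`. -/
theorem BraidGroup.residuallyFinite_succ (n : ℕ) (h : Group.ResiduallyFinite (BraidGroup (n + 1))) :
    Group.ResiduallyFinite (BraidGroup (n + 2)) := by
  have hC : Group.ResiduallyFinite (CombedGroup n) :=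
    SemidirectProduct.residuallyFinite (FreeGroup.residuallyFinite _) h _
  have hB := isBraidFamily_braidGen (n + 1)
  let c := isCombedFamily_combedGroup n
  let ψ : CombedGroup n →* BraidGroup (n + 2) := hB.isCombedFamily.lift
  -- The coset decomposition, as an equivariant map to the group acting on itself.
  let f : Fin (n + 2) × CombedGroup n → BraidGroup (n + 2) :=
    fun y => tailProd n (braidGen (n + 1)) y.1 * ψ y.2
  have hf (b : BraidGroup (n + 2)) (y : Fin (n + 2) × CombedGroup n) :
      f (c.action b y) = b * f y := by
    refine braidGroup_equivariant c.action (MulAction.toPermHom _ (BraidGroup (n + 2))) f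
      (fun i hi y => ?_) b y
    rw [c.action_braidGen hi]
    change tailProd n _ _ * ψ _ = braidGen (n + 1) i * (tailProd n _ _ * ψ _)
    rw [combPerm_fst _ _ hi, combPerm_snd, map_mul, ← mul_assoc, ← mul_assoc,
      hB.mul_tailProd hi y.1.2, hB.isCombedFamily.lift_combFactor hi y.1.2]
  rw [Group.residuallyFinite_iff_exists_finiteIndex]
  intro b hb
  have hb' := hf b (Fin.last (n + 1), 1)
  have hlast : f (Fin.last (n + 1), 1) = 1 := by simp [f, tailProd_last]
  rw [hlast, mul_one] at hb'
  set y := c.action b (Fin.last (n + 1), 1) with hy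
  -- A finite quotient of the combed group in which `b` still moves the base point.
  obtain ⟨N, hN, hfin, hq⟩ : ∃ N : Subgroup (CombedGroup n), ∃ _ : N.Normal,
      Finite (CombedGroup n ⧸ N) ∧
        (y.1, QuotientGroup.mk' N y.2) ≠ (Fin.last (n + 1), (1 : CombedGroup n ⧸ N)) := by
    by_cases hy2 : y.2 = 1
    · refine ⟨⊤, inferInstance, inferInstance, fun h => hb ?_⟩
      rw [← hb', ← hlast]
      exact congrArg f (Prod.ext (Prod.ext_iff.1 h).1 hy2)
    · obtain ⟨N, hN, hfin, hq⟩ := hC.exists_finite_quotient hy2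
      exact ⟨N, hN, hfin, fun h => hq (congrArg Prod.snd h)⟩
  let c' := c.map (QuotientGroup.mk' N)
  have hnat := braidGroup_equivariant c.action c'.action (Prod.map id (QuotientGroup.mk' N))
    (fun i hi z => by
      rw [c.action_braidGen hi, c'.action_braidGen hi]
      refine Prod.ext rfl ?_
      change QuotientGroup.mk' N (combFactor _ _ i z.1 * z.2) =
        combFactor _ _ i z.1 * QuotientGroup.mk' N z.2
      rw [map_mul]
      congr 1
      simp only [combFactor, apply_ite (QuotientGroup.mk' N), map_one, Function.comp_apply])
    b (Fin.last (n + 1), 1)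
  refine ⟨c'.action.ker, Subgroup.finiteIndex_ker _, fun hker => hq ?_⟩
  rw [MonoidHom.mem_ker.1 hker, ← hy] at hnat
  exact hnat

theorem mainTheorem4 (n : ℕ) : Group.ResiduallyFinite (BraidGroup n) := by
  have hsub (m : ℕ) (hm : IsEmpty (Fin (m - 1))) : Group.ResiduallyFinite (BraidGroup m) := by
    have : Subsingleton (BraidGroup m) := (PresentedGroup.mk_surjective (braidRels m)).subsingleton
    infer_instance
  match n with
  | 0 => exact hsub 0 (inferInstanceAs (IsEmpty (Fin 0)))
  | n + 1 =>
    induction n with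
    | zero => exact hsub 1 (inferInstanceAs (IsEmpty (Fin 0)))
    | succ n ih => exact BraidGroup.residuallyFinite_succ n ih
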